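/- Let $R$ be a discrete valuation ring with uniformizer $\pi$, fraction field $K$ and valuation $v$ (normalized by $v(\pi)=1$, with $v(0)=\infty$). Let $f(x)=x^2-ax-b\in R[x]$ be irreducible, let $\theta$ be a root of $f$ (the class of $x$ in $R[x]/(f)$), and let $\mathcal O=R[\theta]\cong R[x]/(f)$. Two non-zero ideals $J_1,J_2$ of $\mathcal O$ are called equivalent if $\alpha_1J_1=\alpha_2J_2$ for some non-zero $\alpha_1,\alpha_2\in\mathcal O$; the equivalence classes are the ideal classes of $\mathcal O$, and their number is the class number of $\mathcal O$. We say that the ideal classes are given by a list of modules if every module in the list is a non-zero ideal of $\mathcal O$ and every ideal class contains exactly one member of the list. "Separable" means separable as a polynomial over $K$. Then the class number of $\mathcal O$ is finite, unless $\operatorname{char}(K)=2$ and $f$ is inseparable. More precisely: 1. If $2\in R^\times$, put $\Delta=\frac{a^2}{4}+b$. Then $v(\Delta)<\infty$ and the ideal classes are given by $$R\pi^k\oplus R\left(\theta-\tfrac a2\right),\qquad 0\le k\le\tfrac12v(\Delta);$$ the class number is $\lfloor\frac12v(\Delta)\rfloor+1$. 2. Suppose $0<e:=v(2)<\infty$.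 (i) If $v(a)<e$, let $m$ be the maximal integer in $\{0,1,\dots,v(a)\}$ such that $v(b-r(r+a))\ge2m$ for some $r\in R$. For every such $r$ (for this $m$), the ideal classes are given by $$R\pi^k\oplus R(r+\theta),\qquad 0\le k\le m;$$ the class number is $m+1$. (ii) If $v(a)\ge e$, then $\frac a2\in R$; put $\Delta=\left(\frac a2\right)^2+b\in R$. Then $(\theta-\frac a2)^2=\Delta$ and $v(\Delta)<\infty$. - If $v(\Delta)$ is odd, the ideal classes are given by $$R\pi^k\oplus R\left(\theta-\tfrac a2\right),\qquad 0\le k\le\left\lfloor\tfrac12v(\Delta)\right\rfloor;$$ the class number is $\lfloor\frac12v(\Delta)\rfloor+1$. - If $v(\Delta)$ is even, let $m$ be the maximal integer in $\{0,1,\dots,e\}$ such that $v(\Delta-r^2)\ge2m+v(\Delta)$ for some $r\in R$. For every such $r$ (for this $m$), the ideal classes are given by $$R\pi^k\oplus R\left(\theta-\tfrac a2\right),\quad 0\le k\le\tfrac12v(\Delta),\qquad\text{and}\qquad R\pi^{\frac12v(\Delta)+i}\oplus R\left(r+\theta-\tfrac a2\right),\quad 1\le i\le m;$$ the class number is $\frac12v(\Delta)+m+1$.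 3. Suppose $2=0$ in $R$. (i) If $f$ is separable, let $m$ be the maximal integer in $\{0,1,\dots,v(a)\}$ such that $v(b-r(r+a))\ge2m$ for some $r\in R$. For every such $r$ (for this $m$), the ideal classes are given by $$R\pi^k\oplus R(r+\theta),\qquad 0\le k\le m;$$ the class number is $m+1$. (ii) If $f$ is inseparable, then $a=0$ and $b=\theta^2$. Let $I$ be the set of all integers $i\ge0$ for which the conditions $u^2+s\pi^i=b$, $v(s)\ge i$ have a solution $u,s\in R$, and fix a solution $(u_i,s_i)$ for each $i\in I$. Then the ideal classes are given by $$Rs_i\oplus R(u_i+\theta),\qquad i\in I.$$ The class number is infinite if and only if $I$ contains every integer $i\ge0$. -/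

import Mathlib

open Polynomial

/-- Two ideals `J₁, J₂` are equivalent if `α₁ J₁ = α₂ J₂` for some non-zero-divisors `α₁, α₂`
(in a domain: for some non-zero `α₁, α₂`). -/
def IdealEquiv {S : Type*} [CommRing S] (J₁ J₂ : Ideal S) : Prop :=
  ∃ α₁ ∈ nonZeroDivisors S, ∃ α₂ ∈ nonZeroDivisors S,
    Ideal.span {α₁} * J₁ = Ideal.span {α₂} * J₂

/-- Equivalence of non-zero ideals. -/
def idealSetoid (S : Type*) [CommRing S] : Setoid {J : Ideal S // J ≠ ⊥} where
  r J₁ J₂ := IdealEquiv J₁.1 J₂.1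
  iseqv :=
    { refl := fun _ => ⟨1, one_mem _, 1, one_mem _, rfl⟩
      symm := fun ⟨α, hα, β, hβ, h⟩ => ⟨β, hβ, α, hα, h.symm⟩
      trans := by
        rintro J₁ J₂ J₃ ⟨α, hα, β, hβ, h⟩ ⟨γ, hγ, δ, hδ, h'⟩
        refine ⟨γ * α, mul_mem hγ hα, β * δ, mul_mem hβ hδ, ?_⟩
        rw [← Ideal.span_singleton_mul_span_singleton, ← Ideal.span_singleton_mul_span_singleton,
          mul_assoc, h, mul_assoc, ← h', mul_left_comm] }

/-- The set of ideal classes of non-zero (not necessarily invertible) ideals of `S`. -/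
def IdealClasses (S : Type*) [CommRing S] : Type _ := Quotient (idealSetoid S)

/-- The class of a non-zero ideal. -/
def idealClass {S : Type*} [CommRing S] (J : {J : Ideal S // J ≠ ⊥}) : IdealClasses S :=
  Quotient.mk (idealSetoid S) J

/-- The ideal `J` of the `R`-algebra `S` is `R x ⊕ R y`, with `x, y` linearly independent. -/
def IsDirectSum (R : Type*) {S : Type*} [CommRing R] [CommRing S] [Algebra R S]
    (J : Ideal S) (x y : S) : Prop :=
  (J : Set S) = (Submodule.span R {x, y} : Set S) ∧ LinearIndependent R ![x, y]

/-- The modules `R x_i ⊕ R y_i` are non-zero ideals of `S`, and every ideal class of `S` is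
represented by exactly one of them. -/
def AreAllIdealClasses (R : Type*) {S : Type*} [CommRing R] [CommRing S] [Algebra R S]
    {ι : Type*} (x y : ι → S) : Prop :=
  ∃ J : ι → {J : Ideal S // J ≠ ⊥},
    (∀ i, IsDirectSum R (J i).1 (x i) (y i)) ∧
    Function.Bijective (fun i => idealClass (J i))

/-- The class number of `S` is finite and equal to `n`. -/
def HasClassNumber (S : Type*) [CommRing S] (n : ℕ) : Prop :=
  Finite (IdealClasses S) ∧ Nat.card (IdealClasses S) = n

/-- The polynomial `x² - a x - b`. -/
noncomputable def quadPoly {R : Type*} [CommRing R] (a b : R) : R[X] :=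
  X ^ 2 - C a * X - C b

/-- The order `R[θ] = R[x]/(x² - a x - b)`. -/
abbrev QuadOrder {R : Type*} [CommRing R] (a b : R) : Type _ := AdjoinRoot (quadPoly a b)

/-- The root `θ` of `x² - a x - b` in `R[θ]`, the class of `x`. -/
noncomputable def quadRoot {R : Type*} [CommRing R] (a b : R) : QuadOrder a b :=
  AdjoinRoot.root (quadPoly a b)

/-- The set of integers `0 ≤ m ≤ v(a)` such that `v(b - r(r + a)) ≥ 2m` for some `r ∈ R`. -/
def levelSet {R : Type*} [CommRing R] [IsDomain R] [IsDiscreteValuationRing R] (a b : R) :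
    Set ℕ :=
  {m | (m : ℕ∞) ≤ IsDiscreteValuationRing.addVal R a ∧
    ∃ r : R, ((2 * m : ℕ) : ℕ∞) ≤ IsDiscreteValuationRing.addVal R (b - r * (r + a))}

/-- The set of integers `0 ≤ m ≤ e` such that `v(Δ - r²) ≥ 2m + v(Δ)` for some `r ∈ R`. -/
def squareLevelSet {R : Type*} [CommRing R] [IsDomain R] [IsDiscreteValuationRing R]
    (e : ℕ) (Δ : R) : Set ℕ :=
  {m | m ≤ e ∧ ∃ r : R, ((2 * m : ℕ) : ℕ∞) + IsDiscreteValuationRing.addVal R Δ ≤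
    IsDiscreteValuationRing.addVal R (Δ - r ^ 2)}

/-- The pair `(u, s)` satisfies `u² + s π^i = b` and `v(s) ≥ i`. -/
def IsSolutionAt {R : Type*} [CommRing R] [IsDomain R] [IsDiscreteValuationRing R]
    (π b : R) (i : ℕ) (u s : R) : Prop :=
  u ^ 2 + s * π ^ i = b ∧ (i : ℕ∞) ≤ IsDiscreteValuationRing.addVal R s

/-!
Dividing a non-zero ideal by a scalar brings it to the form `(t, r + θ)` with `t s = b - r (r + a)`.
Reducing the binary quadratic form `(t, 2 r + a, s)`, it is moreover equivalent to such an ideal for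
which `t` divides `2 r + a` and `s`, that is, to a multiple of an overring `R ⊕ R (r + θ) / t` of
`R[θ]`. For `t = π ^ k` there is at most one such overring, which is recovered from the ideal class
as its ring of multipliers. The ideal classes thus correspond to the exponents `k` which occur.
These form an initial segment of `ℕ`, bounded if the discriminant `a ^ 2 + 4 b` is non-zero, and
each case of the theorem makes this segment explicit.
-/

theorem exists_addVal_eq {R : Type*} [CommRing R] [IsDomain R] [IsDiscreteValuationRing R] {x : R}
    (hx : x ≠ 0) : ∃ n : ℕ, IsDiscreteValuationRing.addVal R x = n :=
  ⟨_, (ENat.natCast_toNat (mt IsDiscreteValuationRing.addVal_eq_top_iff.mp hx)).symm⟩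

theorem pow_dvd_iff_le_addVal {R : Type*} [CommRing R] [IsDomain R] [IsDiscreteValuationRing R]
    {π x : R} (hπ : Irreducible π) {n : ℕ} :
    π ^ n ∣ x ↔ (n : ℕ∞) ≤ IsDiscreteValuationRing.addVal R x := by
  rw [← IsDiscreteValuationRing.addVal_le_iff_dvd, hπ.addVal_pow]

theorem exists_addVal_eq_of_lt_addVal_sub_sq {R : Type*} [CommRing R] [IsDomain R]
    [IsDiscreteValuationRing R] {x d : R} {N : ℕ} (hN : IsDiscreteValuationRing.addVal R x = N)
    (h : N < IsDiscreteValuationRing.addVal R (x - d ^ 2)) :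
    ∃ n : ℕ, IsDiscreteValuationRing.addVal R d = n ∧ N = 2 * n := by
  have hd : d ≠ 0 := by
    rintro rfl
    simp [hN] at h
  obtain ⟨n, hn⟩ := exists_addVal_eq hd
  have hsq : IsDiscreteValuationRing.addVal R (d ^ 2) = N := by
    rw [← hN] at h ⊢
    simpa using AddValuation.map_sub_eq_of_lt_right _ h
  rw [IsDiscreteValuationRing.addVal_pow, hn, nsmul_eq_mul] at hsq
  exact ⟨n, hn, by exact_mod_cast hsq.symm⟩

/-- If `t ∤ d`, then `t = d x`, and cancelling `d ^ 2` makes `x` a divisor of `1`. -/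
theorem dvd_of_sq_dvd_mul_add {R : Type*} [CommRing R] [IsDomain R] [ValuationRing R] {t d e : R}
    (he : t ∣ e) (h : t ^ 2 ∣ d * (d + e)) : t ∣ d := by
  rcases ValuationRing.dvd_total t d with htd | ⟨x, rfl⟩
  · exact htd
  rcases eq_or_ne d 0 with rfl | hd
  · simp
  obtain ⟨c, rfl⟩ := he
  have hx : x ^ 2 ∣ 1 + x * c :=
    (mul_dvd_mul_iff_left (pow_ne_zero 2 hd)).mp (by convert h using 1 <;> ring)
  have hx1 : x ∣ 1 := (dvd_add_left (dvd_mul_right x c)).mp ((dvd_pow_self x two_ne_zero).trans hx)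
  exact (isUnit_of_dvd_one hx1).mul_right_dvd.mpr dvd_rfl

theorem span_singleton_mul_span_pair {S : Type*} [CommRing S] (x y z : S) :
    Ideal.span {x} * Ideal.span {y, z} = Ideal.span {x * y, x * z} := by
  rw [Ideal.span_mul_span', Set.singleton_mul, Set.image_pair]

namespace IdealEquiv

variable {S : Type*} [CommRing S] {I J L : Ideal S}

protected theorem refl (I : Ideal S) : IdealEquiv I I :=
  ⟨1, one_mem _, 1, one_mem _, rfl⟩

protected theorem symm : IdealEquiv I J → IdealEquiv J I :=
  fun ⟨α, hα, β, hβ, h⟩ => ⟨β, hβ, α, hα, h.symm⟩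

protected theorem trans (h : IdealEquiv I J) (h' : IdealEquiv J L) : IdealEquiv I L := by
  obtain ⟨α, hα, β, hβ, h⟩ := h
  obtain ⟨γ, hγ, δ, hδ, h'⟩ := h'
  refine ⟨γ * α, mul_mem hγ hα, β * δ, mul_mem hβ hδ, ?_⟩
  rw [← Ideal.span_singleton_mul_span_singleton, ← Ideal.span_singleton_mul_span_singleton,
    mul_assoc, h, mul_assoc, ← h', mul_left_comm]

theorem span_singleton_mul_le_span_singleton_mul [IsDomain S] (h : IdealEquiv I J) {x y : S}
    (hI : Ideal.span {x} * I ≤ Ideal.span {y} * I) :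
    Ideal.span {x} * J ≤ Ideal.span {y} * J := by
  obtain ⟨α, -, β, hβ, h⟩ := h
  rw [← Ideal.span_singleton_mul_right_mono (nonZeroDivisors.ne_zero hβ)]
  calc Ideal.span {β} * (Ideal.span {x} * J) = Ideal.span {α} * (Ideal.span {x} * I) := by
        rw [mul_left_comm, ← h, mul_left_comm]
    _ ≤ Ideal.span {α} * (Ideal.span {y} * I) := Ideal.mul_mono_right hI
    _ = Ideal.span {β} * (Ideal.span {y} * J) := by rw [mul_left_comm, h, mul_left_comm]

end IdealEquiv

namespace AreAllIdealClasses

variable {R S κ : Type*} [CommRing R] [CommRing S] [Algebra R S] {x y : κ → S}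

theorem nonempty_equiv (h : AreAllIdealClasses R x y) : Nonempty (κ ≃ IdealClasses S) := by
  obtain ⟨J, -, hJ⟩ := h
  exact ⟨Equiv.ofBijective _ hJ⟩

theorem hasClassNumber [Finite κ] (h : AreAllIdealClasses R x y) :
    HasClassNumber S (Nat.card κ) := by
  obtain ⟨e⟩ := h.nonempty_equiv
  exact ⟨.of_equiv κ e, (Nat.card_congr e).symm⟩

end AreAllIdealClasses

section Polynomial

variable {R : Type*} [CommRing R]

theorem quadPoly_monic (a b : R) : (quadPoly a b).Monic := by
  rw [quadPoly]; monicity!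

theorem natDegree_quadPoly [Nontrivial R] (a b : R) : (quadPoly a b).natDegree = 2 := by
  rw [quadPoly]; compute_degree!

theorem map_quadPoly {S : Type*} [CommRing S] (f : R →+* S) (a b : R) :
    (quadPoly a b).map f = quadPoly (f a) (f b) := by
  simp [quadPoly]

theorem separable_quadPoly_iff {K : Type*} [Field K] {α β : K} :
    (quadPoly α β).Separable ↔ α ^ 2 + 4 * β ≠ 0 := by
  have hder : derivative (quadPoly α β) ^ 2 = 4 * quadPoly α β + C (α ^ 2 + 4 * β) := by
    rw [map_add, C_mul, map_pow, map_ofNat C 4]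
    simp only [quadPoly, derivative_sub, derivative_X_pow, derivative_C_mul, derivative_X,
      derivative_C, Nat.cast_ofNat, map_ofNat C 2]
    ring
  constructor
  · intro h h0
    rw [h0, C_0, add_zero] at hder
    have h4 : IsCoprime (quadPoly α β) (4 * quadPoly α β) := hder ▸ h.pow_right
    refine not_isUnit_of_natDegree_pos _ ?_ (h4.isUnit_of_dvd' dvd_rfl (dvd_mul_left _ _))
    rw [natDegree_quadPoly]; exact two_pos
  · intro h
    obtain ⟨u, hu⟩ := h.isUnit.map C
    have h1 : (C (α ^ 2 + 4 * β) : K[X]) * ↑u⁻¹ = 1 := hu ▸ u.mul_inv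
    exact ⟨-4 * ↑u⁻¹, derivative (quadPoly α β) * ↑u⁻¹, by linear_combination h1 + ↑u⁻¹ * hder⟩

theorem separable_map_quadPoly_iff {K : Type*} [Field K] [Algebra R K] [FaithfulSMul R K]
    {a b : R} :
    ((quadPoly a b).map (algebraMap R K)).Separable ↔ a ^ 2 + 4 * b ≠ 0 := by
  rw [map_quadPoly, separable_quadPoly_iff,
    ← map_ne_zero_iff _ (FaithfulSMul.algebraMap_injective R K)]
  simp only [map_add, map_mul, map_pow, map_ofNat]

end Polynomial

namespace QuadOrder

variable {R : Type*} [CommRing R] {a b : R}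

local notation "ι" => algebraMap R (QuadOrder a b)
local notation "θ" => quadRoot a b

theorem quadRoot_sq : θ ^ 2 = ι a * θ + ι b := by
  have h : AdjoinRoot.mk (quadPoly a b) (X ^ 2 - C a * X - C b) = 0 := AdjoinRoot.mk_self
  simp only [map_sub, map_mul, map_pow, AdjoinRoot.mk_X, AdjoinRoot.mk_C] at h
  rw [quadRoot, AdjoinRoot.algebraMap_eq]
  linear_combination h

/-- The coordinate `x` of `x + y θ`. -/
noncomputable def re : QuadOrder a b →ₗ[R] R :=
  lcoeff R 0 ∘ₗ AdjoinRoot.modByMonicHom (quadPoly_monic a b)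

/-- The coordinate `y` of `x + y θ`. -/
noncomputable def im : QuadOrder a b →ₗ[R] R :=
  lcoeff R 1 ∘ₗ AdjoinRoot.modByMonicHom (quadPoly_monic a b)

theorem modByMonicHom_coord (x y : R) :
    AdjoinRoot.modByMonicHom (quadPoly_monic a b) (ι x + ι y * θ) = C y * X + C x := by
  nontriviality R
  have hmk : ι x + ι y * θ = AdjoinRoot.mk (quadPoly a b) (C y * X + C x) := by
    rw [map_add, map_mul, AdjoinRoot.mk_C, AdjoinRoot.mk_C, AdjoinRoot.mk_X, add_comm]; rfl
  rw [hmk, AdjoinRoot.modByMonicHom_mk, modByMonic_eq_self_iff (quadPoly_monic a b),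
    degree_eq_natDegree (quadPoly_monic a b).ne_zero, natDegree_quadPoly]
  exact degree_linear_le.trans_lt (by norm_num)

theorem re_coord (x y : R) : re (ι x + ι y * θ) = x := by
  rw [re, LinearMap.comp_apply, modByMonicHom_coord]
  simp

theorem im_coord (x y : R) : im (ι x + ι y * θ) = y := by
  rw [im, LinearMap.comp_apply, modByMonicHom_coord]
  simp

theorem coord_re_im (z : QuadOrder a b) : ι (re z) + ι (im z) * θ = z := by
  cases subsingleton_or_nontrivial R
  · have := Module.subsingleton R (QuadOrder a b)
    exact Subsingleton.elim _ _
  have hdeg : (AdjoinRoot.modByMonicHom (quadPoly_monic a b) z).natDegree ≤ 1 := by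
    obtain ⟨p, rfl⟩ := AdjoinRoot.mk_surjective z
    rw [AdjoinRoot.modByMonicHom_mk]
    have := natDegree_modByMonic_lt p (quadPoly_monic a b) fun h => by
      simpa [h] using natDegree_quadPoly a b
    rw [natDegree_quadPoly] at this
    lia
  conv_rhs =>
    rw [← AdjoinRoot.mk_leftInverse (quadPoly_monic a b) z,
      eq_X_add_C_of_natDegree_le_one hdeg, map_add, map_mul, AdjoinRoot.mk_C, AdjoinRoot.mk_C,
      AdjoinRoot.mk_X, add_comm]
  rfl

@[ext]
theorem ext {z w : QuadOrder a b} (hre : re z = re w) (him : im z = im w) : z = w := by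
  rw [← coord_re_im z, ← coord_re_im w, hre, him]

@[simp]
theorem re_of (x : R) : re (AdjoinRoot.of (quadPoly a b) x) = x := by
  simpa using re_coord (a := a) (b := b) x 0

@[simp]
theorem im_of (x : R) : im (AdjoinRoot.of (quadPoly a b) x) = 0 := by
  simpa using im_coord (a := a) (b := b) x 0

@[simp]
theorem re_quadRoot : re θ = 0 := by
  simpa using re_coord (a := a) (b := b) 0 1

@[simp]
theorem im_quadRoot : im θ = 1 := by
  simpa using im_coord (a := a) (b := b) 0 1

theorem mul_eq_coord (z w : QuadOrder a b) :
    z * w = ι (re z * re w + b * (im z * im w)) +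
      ι (re z * im w + im z * re w + a * (im z * im w)) * θ := by
  conv_lhs => rw [← coord_re_im z, ← coord_re_im w]
  simp only [map_add, map_mul]
  linear_combination ι (im z) * ι (im w) * quadRoot_sq (a := a) (b := b)

@[simp]
theorem re_mul (z w : QuadOrder a b) : re (z * w) = re z * re w + b * (im z * im w) := by
  rw [mul_eq_coord, re_coord]

@[simp]
theorem im_mul (z w : QuadOrder a b) :
    im (z * w) = re z * im w + im z * re w + a * (im z * im w) := by
  rw [mul_eq_coord, im_coord]

theorem add_quadRoot_mul_add_quadRoot (r : R) :
    (ι r + θ) * (ι (-r - a) + θ) = ι (b - r * (r + a)) := by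
  ext <;> simp <;> ring

theorem quadRoot_sub_sq {c : R} (hc : 2 * c = a) : (θ - ι c) ^ 2 = ι (c ^ 2 + b) := by
  subst hc
  have hθ := quadRoot_sq (a := 2 * c) (b := b)
  simp only [map_add, map_pow, map_mul, map_ofNat] at hθ ⊢
  linear_combination hθ

theorem add_quadRoot_ne_zero [Nontrivial (QuadOrder a b)] (r : R) : ι r + θ ≠ 0 := fun h =>
  have := Module.nontrivial R (QuadOrder a b)
  one_ne_zero (by simpa using congrArg im h : (1 : R) = 0)

theorem algebraMap_injective : Function.Injective ι :=
  Function.LeftInverse.injective (g := re) fun x => by simp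

theorem isDomain [UniqueFactorizationMonoid R] (hf : Irreducible (quadPoly a b)) :
    IsDomain (QuadOrder a b) :=
  AdjoinRoot.isDomain_of_prime hf.prime

section IsDomain

variable [IsDomain (QuadOrder a b)]

theorem sub_mul_add_ne_zero (r : R) : b - r * (r + a) ≠ 0 := fun h => by
  have h0 := add_quadRoot_mul_add_quadRoot (a := a) (b := b) r
  rw [h, map_zero] at h0
  exact mul_ne_zero (add_quadRoot_ne_zero r) (add_quadRoot_ne_zero _) h0

theorem sq_add_ne_zero {c : R} (hc : 2 * c = a) : c ^ 2 + b ≠ 0 := by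
  convert sub_mul_add_ne_zero (a := a) (b := b) (-c) using 1
  linear_combination c * hc

/-- If the discriminant vanishes, then so does `(2 θ - a) ^ 2`. -/
theorem two_eq_zero_and_eq_zero_of_disc_eq_zero (h : a ^ 2 + 4 * b = 0) :
    (2 : R) = 0 ∧ a = 0 := by
  have hsq : (2 * θ - ι a) ^ 2 = ι (a ^ 2 + 4 * b) := by
    simp only [map_add, map_mul, map_pow, map_ofNat]
    linear_combination 4 * quadRoot_sq (a := a) (b := b)
  rw [h, map_zero, sq_eq_zero_iff, ← map_ofNat ι 2] at hsq
  exact ⟨by simpa using congrArg im hsq, by simpa using congrArg re hsq⟩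

end IsDomain

section StdIdeal

/-- The ideal `(t, r + θ)`. It is the module `R t ⊕ R (r + θ)` as soon as `t` divides the norm
`r (r + a) - b` of `r + θ`; divisibility is always stated for the negative of this norm. -/
noncomputable def stdIdeal (a b t r : R) : Ideal (QuadOrder a b) :=
  Ideal.span {algebraMap R (QuadOrder a b) t, algebraMap R (QuadOrder a b) r + quadRoot a b}

variable {r t : R}

theorem algebraMap_mem_stdIdeal : ι t ∈ stdIdeal a b t r :=
  Ideal.subset_span (by simp)

theorem add_quadRoot_mem_stdIdeal : ι r + θ ∈ stdIdeal a b t r :=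
  Ideal.subset_span (by simp)

theorem stdIdeal_ne_bot [Nontrivial (QuadOrder a b)] : stdIdeal a b t r ≠ ⊥ :=
  fun h => add_quadRoot_ne_zero r (Ideal.mem_bot.mp (h ▸ add_quadRoot_mem_stdIdeal))

theorem stdIdeal_congr_left {t' : R} (h : Associated t t') :
    stdIdeal a b t r = stdIdeal a b t' r := by
  obtain ⟨u, rfl⟩ := h
  rw [stdIdeal, stdIdeal, Ideal.span_insert, Ideal.span_insert, map_mul,
    Ideal.span_singleton_mul_right_unit (u.isUnit.map ι)]

theorem stdIdeal_congr_right {r' : R} (h : t ∣ r' - r) :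
    stdIdeal a b t r = stdIdeal a b t r' := by
  obtain ⟨x, hx⟩ := h
  have h' : ι r' + θ = ι r + θ + ι x * ι t := by
    rw [← map_mul, mul_comm x, ← hx, map_sub]; ring
  rw [stdIdeal, stdIdeal, h', Ideal.span_pair_add_mul_left]

theorem mem_stdIdeal (ht : t ∣ b - r * (r + a)) {z : QuadOrder a b} :
    z ∈ stdIdeal a b t r ↔ t ∣ re z - r * im z := by
  rw [stdIdeal, Ideal.mem_span_pair]
  constructor
  · rintro ⟨x, y, rfl⟩
    obtain ⟨s, hs⟩ := ht
    refine ⟨re x - r * im x + im y * s, ?_⟩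
    simp only [map_add, re_mul, im_mul, AdjoinRoot.algebraMap_eq, re_of, im_of, re_quadRoot,
      im_quadRoot]
    linear_combination im y * hs
  · rintro ⟨x, hx⟩
    have hre : x * t + im z * r = re z := by linear_combination -hx
    exact ⟨ι x, ι (im z), by ext <;> simp [hre]⟩

theorem isDirectSum_stdIdeal [NoZeroDivisors R] (ht : t ∣ b - r * (r + a)) (ht0 : t ≠ 0) :
    IsDirectSum R (stdIdeal a b t r) (ι t) (ι r + θ) := by
  constructor
  · ext z
    rw [SetLike.mem_coe, mem_stdIdeal ht, SetLike.mem_coe, Submodule.mem_span_pair]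
    constructor
    · rintro ⟨x, hx⟩
      have hre : x * t + im z * r = re z := by linear_combination -hx
      exact ⟨x, im z, by ext <;> simp [hre]⟩
    · rintro ⟨x, y, rfl⟩
      exact ⟨x, by simp [mul_comm t, mul_comm r]⟩
  · refine LinearIndependent.pair_iff.mpr fun x y h => ?_
    have hy : y = 0 := by simpa using congrArg im h
    exact ⟨by simpa [hy, ht0] using congrArg re h, hy⟩

/-- Multiplying `(t, r + θ)` by the conjugate of `r + θ` gives `t (s, conj (r + θ))`. -/
theorem idealEquiv_conj [IsDomain (QuadOrder a b)] {s : R} (h : b - r * (r + a) = t * s) :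
    IdealEquiv (stdIdeal a b t r) (stdIdeal a b s (-r - a)) := by
  have ht : t ≠ 0 := left_ne_zero_of_mul (h ▸ sub_mul_add_ne_zero r)
  refine ⟨ι (-r - a) + θ, mem_nonZeroDivisors_of_ne_zero (add_quadRoot_ne_zero _), ι t,
    mem_nonZeroDivisors_of_ne_zero ((map_ne_zero_iff _ algebraMap_injective).mpr ht), ?_⟩
  rw [stdIdeal, stdIdeal, span_singleton_mul_span_pair, span_singleton_mul_span_pair,
    mul_comm _ (ι r + θ), add_quadRoot_mul_add_quadRoot, h, map_mul, Ideal.span_pair_comm,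
    mul_comm (ι t) (_ + θ)]

end StdIdeal

section NormalForm

variable [IsPrincipalIdealRing R]

theorem exists_eq_stdIdeal_of_add_quadRoot_mem {J : Ideal (QuadOrder a b)} {r : R}
    (h : ι r + θ ∈ J) : ∃ t, t ∣ b - r * (r + a) ∧ J = stdIdeal a b t r := by
  obtain ⟨t, ht⟩ := (IsPrincipalIdealRing.principal (J.comap ι)).principal
  have mem_iff (x : R) : ι x ∈ J ↔ t ∣ x := by
    rw [← Ideal.mem_comap, ht]; exact Ideal.mem_span_singleton
  have hnorm : t ∣ b - r * (r + a) := by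
    rw [← mem_iff, ← add_quadRoot_mul_add_quadRoot]
    exact J.mul_mem_right _ h
  refine ⟨t, hnorm, ?_⟩
  ext z
  have hz : z = ι (re z - r * im z) + ι (im z) * (ι r + θ) := by ext <;> simp [mul_comm r]
  rw [mem_stdIdeal hnorm, ← mem_iff]
  nth_rewrite 1 [hz]
  exact J.add_mem_iff_left (J.mul_mem_left _ h)

/-- The coordinate `im` maps `J` onto an ideal of `R`; since `re z = im (θ z) - a im z`, its
generator divides both coordinates of every element of `J`. -/
theorem exists_eq_span_algebraMap_mul [IsDomain R] {J : Ideal (QuadOrder a b)}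
    (hJ : J ≠ ⊥) : ∃ g : R, g ≠ 0 ∧ ∃ (r : R) (J' : Ideal (QuadOrder a b)),
      ι r + θ ∈ J' ∧ J = Ideal.span {ι g} * J' := by
  obtain ⟨g, hg⟩ := (IsPrincipalIdealRing.principal ((J.restrictScalars R).map im)).principal
  have him {z} (hz : z ∈ J) : g ∣ im z :=
    Ideal.mem_span_singleton.mp (hg.le (Submodule.mem_map_of_mem hz))
  have hre {z} (hz : z ∈ J) : g ∣ re z :=
    (dvd_add_left ((him hz).mul_left a)).mp (by simpa using him (J.mul_mem_left θ hz))
  obtain ⟨z₀, hz₀, hz₀g⟩ : ∃ z ∈ J, im z = g := hg.ge (Ideal.mem_span_singleton_self g)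
  have hg0 : g ≠ 0 := by
    rintro rfl
    exact hJ ((Submodule.eq_bot_iff J).mpr fun z hz =>
      QuadOrder.ext (by simpa using hre hz) (by simpa using him hz))
  have hdiv {z} (hz : z ∈ J) : ∃ w, ι g * w = z := by
    obtain ⟨x, hx⟩ := hre hz
    obtain ⟨y, hy⟩ := him hz
    exact ⟨ι x + ι y * θ, by ext <;> simp [hx, hy]⟩
  obtain ⟨w, rfl⟩ := hdiv hz₀
  refine ⟨g, hg0, re w, Submodule.comap (LinearMap.mul _ _ (ι g)) J, ?_, ?_⟩
  · have hw : im w = 1 := by simpa [hg0] using hz₀g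
    have : ι (re w) + θ = w := by ext <;> simp [hw]
    rwa [this]
  · ext z
    rw [Ideal.mem_span_singleton_mul]
    constructor
    · intro hz
      obtain ⟨w, rfl⟩ := hdiv hz
      exact ⟨w, hz, rfl⟩
    · rintro ⟨w, hw, rfl⟩
      exact hw

theorem exists_idealEquiv_stdIdeal [IsDomain R] [IsDomain (QuadOrder a b)]
    {J : Ideal (QuadOrder a b)} (hJ : J ≠ ⊥) :
    ∃ t r, t ∣ b - r * (r + a) ∧ IdealEquiv J (stdIdeal a b t r) := by
  obtain ⟨g, hg, r, J', hr, rfl⟩ := exists_eq_span_algebraMap_mul hJ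
  obtain ⟨t, ht, rfl⟩ := exists_eq_stdIdeal_of_add_quadRoot_mem hr
  refine ⟨t, r, ht, 1, one_mem _, ι g, mem_nonZeroDivisors_of_ne_zero
    ((map_ne_zero_iff _ algebraMap_injective).mpr hg), ?_⟩
  rw [Ideal.span_singleton_one, Ideal.one_eq_top.symm, one_mul]

end NormalForm

section IsOverorder

/-- The element `(r + θ) / t` has its trace and its norm in `R`, so that `R ⊕ R (r + θ) / t` is a
ring containing `R[θ]`; multiplied by `t` it becomes the ideal `stdIdeal a b t r`. -/
def IsOverorder (a b t r : R) : Prop :=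
  t ∣ 2 * r + a ∧ t ^ 2 ∣ b - r * (r + a)

namespace IsOverorder

variable {t t' r r' : R}

theorem dvd_norm (h : IsOverorder a b t r) : t ∣ b - r * (r + a) :=
  (dvd_pow_self t two_ne_zero).trans h.2

theorem of_dvd (h : IsOverorder a b t r) (ht : t' ∣ t) : IsOverorder a b t' r :=
  ⟨ht.trans h.1, (pow_dvd_pow_of_dvd ht 2).trans h.2⟩

theorem span_mul_stdIdeal_le (h : IsOverorder a b t r) :
    Ideal.span {ι r + θ} * stdIdeal a b t r ≤ Ideal.span {ι t} * stdIdeal a b t r := by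
  obtain ⟨⟨x, hx⟩, y, hy⟩ := h
  have hsq : (ι r + θ) * (ι r + θ) = ι t * (ι x * (ι r + θ) + ι (t * y) ) := by
    have hx' := congrArg ι hx
    have hy' := congrArg ι hy
    simp only [map_add, map_sub, map_mul, map_pow, map_ofNat] at hx' hy' ⊢
    linear_combination quadRoot_sq (a := a) (b := b) + (ι r + θ) * hx' + hy'
  conv_lhs => rw [stdIdeal, span_singleton_mul_span_pair]
  rw [Ideal.span_le, Set.pair_subset_iff, SetLike.mem_coe, SetLike.mem_coe, hsq,
    mul_comm _ (ι t)]
  refine ⟨Ideal.mul_mem_mul (Ideal.mem_span_singleton_self _) add_quadRoot_mem_stdIdeal,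
    Ideal.mul_mem_mul (Ideal.mem_span_singleton_self _) (add_mem ?_ ?_)⟩
  · exact Ideal.mul_mem_left _ _ add_quadRoot_mem_stdIdeal
  · rw [map_mul]
    exact Ideal.mul_mem_right _ _ algebraMap_mem_stdIdeal

theorem dvd_of_idealEquiv [IsDomain (QuadOrder a b)] (h : IsOverorder a b t r)
    (hI : IdealEquiv (stdIdeal a b t r) (stdIdeal a b t' r')) : t ∣ t' := by
  have hmem : (ι r + θ) * ι t' ∈ Ideal.span {ι t} * stdIdeal a b t' r' :=
    hI.span_singleton_mul_le_span_singleton_mul h.span_mul_stdIdeal_le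
      (Ideal.mul_mem_mul (Ideal.mem_span_singleton_self _) algebraMap_mem_stdIdeal)
  obtain ⟨w, -, hw⟩ := Ideal.mem_span_singleton_mul.mp hmem
  exact ⟨im w, by simpa using (congrArg im hw).symm⟩

theorem dvd_sub [IsDomain R] [ValuationRing R] (h : IsOverorder a b t r)
    (h' : IsOverorder a b t r') : t ∣ r' - r := by
  refine dvd_of_sq_dvd_mul_add h.1 ?_
  convert _root_.dvd_sub h.2 h'.2 using 1
  ring

end IsOverorder

theorem isOverorder_sub_iff {c d t : R} (hc : 2 * c = a) :
    IsOverorder a b t (d - c) ↔ t ∣ 2 * d ∧ t ^ 2 ∣ c ^ 2 + b - d ^ 2 := by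
  subst hc
  rw [IsOverorder]
  ring_nf

variable [IsDomain (QuadOrder a b)] {r s t : R}

theorem exists_isOverorder_of_dvd_dvd (h : b - r * (r + a) = t * s)
    (hts : t ∣ 2 * r + a ∧ t ∣ s ∨ s ∣ 2 * r + a ∧ s ∣ t) :
    ∃ t' r', IsOverorder a b t' r' ∧ IdealEquiv (stdIdeal a b t r) (stdIdeal a b t' r') := by
  rcases hts with ⟨ht, hs⟩ | ⟨hs, ht⟩
  · exact ⟨t, r, ⟨ht, by rw [h, sq]; exact mul_dvd_mul_left t hs⟩, .refl _⟩
  · refine ⟨s, -r - a, ⟨?_, ?_⟩, idealEquiv_conj h⟩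
    · convert (dvd_neg.mpr hs) using 1
      ring
    · have h' : b - (-r - a) * (-r - a + a) = t * s := by rw [← h]; ring
      rw [h', sq]
      exact mul_dvd_mul_right ht s

/-- Reduction of the binary quadratic form `(t, 2 r + a, s)`. If its middle coefficient divides
both outer ones properly, then translating `r` by `t` replaces `s` by an associate of `2 r + a`. -/
theorem exists_isOverorder_idealEquiv [IsDomain R] [ValuationRing R]
    (ht : t ∣ b - r * (r + a)) :
    ∃ t' r', IsOverorder a b t' r' ∧ IdealEquiv (stdIdeal a b t r) (stdIdeal a b t' r') := by
  obtain ⟨s, h⟩ := ht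
  by_cases hts : t ∣ 2 * r + a ∧ t ∣ s ∨ s ∣ 2 * r + a ∧ s ∣ t
  · exact exists_isOverorder_of_dvd_dvd h hts
  obtain ⟨⟨x, hx⟩, y, hy⟩ : 2 * r + a ∣ t ∧ 2 * r + a ∣ s := by
    grind [ValuationRing.dvd_total t (2 * r + a), ValuationRing.dvd_total s (2 * r + a),
      ValuationRing.dvd_total t s, dvd_trans]
  have hx_mem : x ∈ IsLocalRing.maximalIdeal R := fun hu =>
    hts (.inl ⟨hx ▸ hu.mul_right_dvd.mpr dvd_rfl, hx ▸ hu.mul_right_dvd.mpr ⟨y, hy⟩⟩)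
  have hy_mem : y ∈ IsLocalRing.maximalIdeal R := fun hu =>
    hts (.inr ⟨hy ▸ hu.mul_right_dvd.mpr dvd_rfl, hy ▸ hu.mul_right_dvd.mpr ⟨x, hx⟩⟩)
  have hunit : IsUnit (1 - (y - x)) :=
    IsLocalRing.isUnit_one_sub_self_of_mem_nonunits _ (sub_mem hy_mem hx_mem)
  have hs : s - t - (2 * r + a) ∣ 2 * r + a := by
    have hs' : s - t - (2 * r + a) = (2 * r + a) * -(1 - (y - x)) := by
      linear_combination hy - hx
    rw [hs']
    exact hunit.neg.mul_right_dvd.mpr dvd_rfl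
  have hst : s - t - (2 * r + a) ∣ t := hs.trans ⟨x, hx⟩
  rw [stdIdeal_congr_right (r' := r + t) (by rw [add_sub_cancel_left])]
  refine exists_isOverorder_of_dvd_dvd (s := s - t - (2 * r + a)) (by linear_combination h)
    (.inr ⟨?_, hst⟩)
  convert dvd_add hs (hst.mul_left 2) using 1
  ring

end IsOverorder

section Levels

/-- The exponents `k` such that some `r` makes `R ⊕ R (r + θ) / π ^ k` a ring. This ring depends on
`k` only, and the ideals of `R[θ]` are up to equivalence the multiples of these rings. -/
def overorderLevels (π a b : R) : Set ℕ :=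
  {k | ∃ r, IsOverorder a b (π ^ k) r}

variable {π : R}

theorem isLowerSet_overorderLevels : IsLowerSet (overorderLevels π a b) :=
  fun _ _ hkl ⟨r, hr⟩ => ⟨r, hr.of_dvd (pow_dvd_pow π hkl)⟩

theorem zero_mem_overorderLevels : 0 ∈ overorderLevels π a b :=
  ⟨0, by simp [IsOverorder]⟩

variable [IsDomain R] [IsDiscreteValuationRing R]

/-- Every level `k` satisfies `π ^ k ∣ (2 r + a) ^ 2 + 4 (b - r (r + a)) = a ^ 2 + 4 b`. -/
theorem exists_notMem_overorderLevels (hπ : Irreducible π) (h : a ^ 2 + 4 * b ≠ 0) :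
    ∃ k, k ∉ overorderLevels π a b := by
  obtain ⟨n, hn⟩ := FiniteMultiplicity.of_not_isUnit hπ.not_isUnit h
  refine ⟨n + 1, fun ⟨r, hr⟩ => hn ?_⟩
  convert dvd_add (dvd_pow hr.1 two_ne_zero) (hr.dvd_norm.mul_left 4) using 1
  ring

theorem exists_isGreatest_overorderLevels (hπ : Irreducible π) (h : a ^ 2 + 4 * b ≠ 0) :
    ∃ m, IsGreatest (overorderLevels π a b) m := by
  obtain ⟨n, hn⟩ := exists_notMem_overorderLevels hπ h
  refine BddAbove.exists_isGreatest_of_nonempty ⟨n, fun k hk => ?_⟩ ⟨0, zero_mem_overorderLevels⟩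
  exact le_of_not_ge fun hnk => hn (isLowerSet_overorderLevels hnk hk)

variable [IsDomain (QuadOrder a b)]

theorem exists_isOverorder_pow_idealEquiv (hπ : Irreducible π) {J : Ideal (QuadOrder a b)}
    (hJ : J ≠ ⊥) :
    ∃ k r, IsOverorder a b (π ^ k) r ∧ IdealEquiv J (stdIdeal a b (π ^ k) r) := by
  obtain ⟨t₀, r₀, ht₀, hJ₀⟩ := exists_idealEquiv_stdIdeal hJ
  obtain ⟨t, r, hr, hJ⟩ := exists_isOverorder_idealEquiv ht₀
  have ht : t ≠ 0 := ne_zero_of_dvd_ne_zero (sub_mul_add_ne_zero r) hr.dvd_norm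
  obtain ⟨k, hk⟩ := IsDiscreteValuationRing.associated_pow_irreducible ht hπ
  exact ⟨k, r, hr.of_dvd hk.symm.dvd, stdIdeal_congr_left (r := r) hk ▸ hJ₀.trans hJ⟩

section Families

variable {κ : Type*} {k : κ → ℕ} {r : κ → R}

theorem bijective_idealClass (hπ : Irreducible π) (hk : k.Injective)
    (hr : ∀ i, IsOverorder a b (π ^ k i) (r i)) (hrange : overorderLevels π a b ⊆ Set.range k)
    {J : κ → {J : Ideal (QuadOrder a b) // J ≠ ⊥}}
    (hJ : ∀ i, IdealEquiv (J i).1 (stdIdeal a b (π ^ k i) (r i))) :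
    Function.Bijective fun i => idealClass (J i) := by
  constructor
  · have le_of_class_eq {i j} (hij : idealClass (J i) = idealClass (J j)) : k i ≤ k j :=
      (pow_dvd_pow_iff hπ.ne_zero hπ.not_isUnit).mp <|
        (hr i).dvd_of_idealEquiv ((hJ i).symm.trans ((Quotient.exact hij).trans (hJ j)))
    exact fun i j hij => hk ((le_of_class_eq hij).antisymm (le_of_class_eq hij.symm))
  · refine Quotient.ind fun L => ?_
    obtain ⟨n, s, hs, hL⟩ := exists_isOverorder_pow_idealEquiv hπ L.2
    obtain ⟨i, rfl⟩ := hrange ⟨s, hs⟩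
    rw [stdIdeal_congr_right (hs.dvd_sub (hr i))] at hL
    exact ⟨i, Quotient.sound ((hJ i).trans hL.symm)⟩

theorem areAllIdealClasses_of_idealEquiv (hπ : Irreducible π) (hk : k.Injective)
    (hr : ∀ i, IsOverorder a b (π ^ k i) (r i)) (hrange : overorderLevels π a b ⊆ Set.range k)
    {t u : κ → R} (ht : ∀ i, t i ∣ b - u i * (u i + a))
    (hJ : ∀ i, IdealEquiv (stdIdeal a b (t i) (u i)) (stdIdeal a b (π ^ k i) (r i))) :
    AreAllIdealClasses R (fun i => ι (t i)) (fun i => ι (u i) + θ) :=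
  ⟨fun i => ⟨stdIdeal a b (t i) (u i), stdIdeal_ne_bot⟩,
    fun i => isDirectSum_stdIdeal (ht i)
      (ne_zero_of_dvd_ne_zero (sub_mul_add_ne_zero (u i)) (ht i)),
    bijective_idealClass hπ hk hr hrange hJ⟩

theorem areAllIdealClasses (hπ : Irreducible π) (hk : k.Injective)
    (hr : ∀ i, IsOverorder a b (π ^ k i) (r i)) (hrange : overorderLevels π a b ⊆ Set.range k) :
    AreAllIdealClasses R (fun i => ι (π ^ k i)) (fun i => ι (r i) + θ) :=
  areAllIdealClasses_of_idealEquiv hπ hk hr hrange (fun i => (hr i).dvd_norm) fun _ => .refl _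

end Families

theorem nonempty_overorderLevels_equiv (hπ : Irreducible π) :
    Nonempty (overorderLevels π a b ≃ IdealClasses (QuadOrder a b)) := by
  choose r hr using fun k : overorderLevels π a b => k.2
  exact (areAllIdealClasses hπ Subtype.val_injective hr Subtype.range_val.ge).nonempty_equiv

theorem infinite_idealClasses_iff (hπ : Irreducible π) :
    Infinite (IdealClasses (QuadOrder a b)) ↔ ∀ k, k ∈ overorderLevels π a b := by
  obtain ⟨e⟩ := nonempty_overorderLevels_equiv (a := a) (b := b) hπ
  rw [← e.infinite_iff, Set.infinite_coe_iff]
  constructor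
  · intro h k
    obtain ⟨l, hl, hkl⟩ := h.exists_gt k
    exact isLowerSet_overorderLevels hkl.le hl
  · intro h
    rw [Set.eq_univ_of_forall h]
    exact Set.infinite_univ

theorem finite_idealClasses (hπ : Irreducible π) (h : a ^ 2 + 4 * b ≠ 0) :
    Finite (IdealClasses (QuadOrder a b)) := by
  rw [← not_infinite_iff_finite, infinite_idealClasses_iff hπ, not_forall]
  exact exists_notMem_overorderLevels hπ h

section IsGreatest

variable {m : ℕ}

theorem areAllIdealClasses_of_isGreatest (hπ : Irreducible π)
    (hm : IsGreatest (overorderLevels π a b) m) {r : R} (hr : IsOverorder a b (π ^ m) r) :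
    AreAllIdealClasses R (fun k : Fin (m + 1) => ι (π ^ (k : ℕ))) (fun _ => ι r + θ) :=
  areAllIdealClasses hπ Fin.val_injective
    (fun k => hr.of_dvd (pow_dvd_pow π (Nat.lt_succ_iff.mp k.2)))
    fun k hk => ⟨⟨k, Nat.lt_succ_iff.mpr (hm.2 hk)⟩, rfl⟩

theorem hasClassNumber_of_isGreatest (hπ : Irreducible π)
    (hm : IsGreatest (overorderLevels π a b) m) : HasClassNumber (QuadOrder a b) (m + 1) := by
  obtain ⟨r, hr⟩ := hm.1
  simpa using (areAllIdealClasses_of_isGreatest hπ hm hr).hasClassNumber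

end IsGreatest

end Levels

section Valuation

open IsDiscreteValuationRing (addVal)

variable [IsDomain R] [IsDiscreteValuationRing R] {π : R}

theorem isOverorder_pow_iff (hπ : Irreducible π) {k : ℕ} {r : R} :
    IsOverorder a b (π ^ k) r ↔
      k ≤ addVal R (2 * r + a) ∧ ((2 * k : ℕ) : ℕ∞) ≤ addVal R (b - r * (r + a)) := by
  rw [IsOverorder, ← pow_mul, mul_comm k, pow_dvd_iff_le_addVal hπ, pow_dvd_iff_le_addVal hπ]

theorem isOverorder_pow_iff_of_addVal_lt (hπ : Irreducible π) (h : addVal R a < addVal R 2)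
    {k : ℕ} {r : R} :
    IsOverorder a b (π ^ k) r ↔
      k ≤ addVal R a ∧ ((2 * k : ℕ) : ℕ∞) ≤ addVal R (b - r * (r + a)) := by
  have h2r : addVal R a < addVal R (2 * r) :=
    h.trans_le (by rw [IsDiscreteValuationRing.addVal_mul]; exact le_self_add)
  rw [isOverorder_pow_iff hπ, AddValuation.map_add_eq_of_lt_right _ h2r]

theorem overorderLevels_eq_levelSet (hπ : Irreducible π) (h : addVal R a < addVal R 2) :
    overorderLevels π a b = levelSet a b := by
  ext k
  simp only [overorderLevels, levelSet, Set.mem_ofPred_eq, isOverorder_pow_iff_of_addVal_lt hπ h,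
    exists_and_left]

theorem disc_ne_zero_of_addVal_lt [IsDomain (QuadOrder a b)] (h : addVal R a < addVal R 2) :
    a ^ 2 + 4 * b ≠ 0 := fun h0 => by
  obtain ⟨h2, rfl⟩ := two_eq_zero_and_eq_zero_of_disc_eq_zero h0
  exact h.ne (by rw [h2])

theorem exists_isGreatest_levelSet_and_hasClassNumber [IsDomain (QuadOrder a b)]
    (hπ : Irreducible π) (h : addVal R a < addVal R 2) :
    ∃ m : ℕ, IsGreatest (levelSet a b) m ∧
      (∀ r : R, ((2 * m : ℕ) : ℕ∞) ≤ addVal R (b - r * (r + a)) →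
        AreAllIdealClasses R (fun k : Fin (m + 1) => ι (π ^ (k : ℕ))) (fun _ => ι r + θ)) ∧
      HasClassNumber (QuadOrder a b) (m + 1) := by
  obtain ⟨m, hm⟩ := exists_isGreatest_overorderLevels hπ (disc_ne_zero_of_addVal_lt (b := b) h)
  have hm' := hm
  rw [overorderLevels_eq_levelSet hπ h] at hm'
  exact ⟨m, hm', fun r hr => areAllIdealClasses_of_isGreatest hπ hm <|
    (isOverorder_pow_iff_of_addVal_lt hπ h).mpr ⟨hm'.1.1, hr⟩, hasClassNumber_of_isGreatest hπ hm⟩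

section Half

variable {c d : R} {k : ℕ}

theorem isOverorder_pow_sub_iff (hπ : Irreducible π) (hc : 2 * c = a) :
    IsOverorder a b (π ^ k) (d - c) ↔
      k ≤ addVal R (2 * d) ∧ ((2 * k : ℕ) : ℕ∞) ≤ addVal R (c ^ 2 + b - d ^ 2) := by
  rw [isOverorder_sub_iff hc, ← pow_mul, mul_comm k, pow_dvd_iff_le_addVal hπ,
    pow_dvd_iff_le_addVal hπ]

theorem isOverorder_pow_neg_iff (hπ : Irreducible π) (hc : 2 * c = a) :
    IsOverorder a b (π ^ k) (-c) ↔ ((2 * k : ℕ) : ℕ∞) ≤ addVal R (c ^ 2 + b) := by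
  simpa using isOverorder_pow_sub_iff (b := b) (d := 0) (k := k) hπ hc

theorem isOverorder_pow_add_sub_iff (hπ : Irreducible π) (hc : 2 * c = a) {n e i : ℕ}
    (hn : addVal R (c ^ 2 + b) = (2 * n : ℕ)) (he : addVal R 2 = e) :
    IsOverorder a b (π ^ (n + i)) (d - c) ↔
      i ≤ e ∧ ((2 * i : ℕ) : ℕ∞) + addVal R (c ^ 2 + b) ≤ addVal R (c ^ 2 + b - d ^ 2) := by
  rw [isOverorder_pow_sub_iff hπ hc, IsDiscreteValuationRing.addVal_mul, he, hn,
    ← Nat.cast_add (2 * i), mul_add, add_comm (2 * n)]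
  refine and_congr_left fun h => ?_
  rcases i.eq_zero_or_pos with rfl | hi
  · have hd : (π ^ n) ^ 2 ∣ d ^ 2 := by
      rw [← pow_mul, mul_comm n, ← dvd_sub_right ((pow_dvd_iff_le_addVal hπ).mpr hn.ge)]
      exact (pow_dvd_iff_le_addVal hπ).mpr (by simpa using h)
    rw [IsIntegrallyClosed.pow_dvd_pow_iff two_ne_zero, pow_dvd_iff_le_addVal hπ] at hd
    simpa using hd.trans le_add_self
  · obtain ⟨j, hj, hnj⟩ := exists_addVal_eq_of_lt_addVal_sub_sq hn
      (h.trans_lt' (by norm_cast; lia))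
    rw [hj]
    norm_cast
    lia

theorem exists_isGreatest_squareLevelSet (e : ℕ) (Δ : R) :
    ∃ m, IsGreatest (squareLevelSet e Δ) m :=
  BddAbove.exists_isGreatest_of_nonempty ⟨e, fun _ h => h.1⟩ ⟨0, zero_le, 0, by simp⟩

theorem isGreatest_overorderLevels_of_even (hπ : Irreducible π) (hc : 2 * c = a) {n e m : ℕ}
    (hn : addVal R (c ^ 2 + b) = (2 * n : ℕ)) (he : addVal R 2 = e)
    (hm : IsGreatest (squareLevelSet e (c ^ 2 + b)) m) :
    IsGreatest (overorderLevels π a b) (n + m) := by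
  obtain ⟨⟨hme, r, hr⟩, hmax⟩ := hm
  refine ⟨⟨r - c, (isOverorder_pow_add_sub_iff hπ hc hn he).mpr ⟨hme, hr⟩⟩, ?_⟩
  rintro k ⟨r, hr⟩
  rcases le_total k n with hkn | hnk
  · exact hkn.trans (Nat.le_add_right n m)
  obtain ⟨i, rfl⟩ := Nat.exists_eq_add_of_le hnk
  rw [← add_sub_cancel_right r c, isOverorder_pow_add_sub_iff hπ hc hn he] at hr
  exact Nat.add_le_add_left (hmax ⟨hr.1, r + c, hr.2⟩) n

variable [IsDomain (QuadOrder a b)]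

theorem areAllIdealClasses_and_hasClassNumber_of_forall_le (hπ : Irreducible π) (hc : 2 * c = a)
    {N : ℕ} (hN : addVal R (c ^ 2 + b) = N)
    (hle : ∀ k d, IsOverorder a b (π ^ k) (d - c) → 2 * k ≤ N) :
    AreAllIdealClasses R (fun k : Fin (N / 2 + 1) => ι (π ^ (k : ℕ))) (fun _ => θ - ι c) ∧
      HasClassNumber (QuadOrder a b) (N / 2 + 1) := by
  have hneg : IsOverorder a b (π ^ (N / 2)) (-c) := by
    rw [isOverorder_pow_neg_iff hπ hc, hN]
    exact_mod_cast Nat.mul_div_le N 2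
  have hm : IsGreatest (overorderLevels π a b) (N / 2) := by
    refine ⟨⟨-c, hneg⟩, fun k ⟨r, hr⟩ => ?_⟩
    have := hle k (r + c) (by rwa [add_sub_cancel_right])
    lia
  refine ⟨?_, hasClassNumber_of_isGreatest hπ hm⟩
  simpa only [map_neg, neg_add_eq_sub] using areAllIdealClasses_of_isGreatest hπ hm hneg

theorem areAllIdealClasses_and_hasClassNumber_of_isUnit_two (hπ : Irreducible π)
    (h2 : IsUnit (2 : R)) (hc : 2 * c = a) {N : ℕ} (hN : addVal R (c ^ 2 + b) = N) :
    AreAllIdealClasses R (fun k : Fin (N / 2 + 1) => ι (π ^ (k : ℕ))) (fun _ => θ - ι c) ∧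
      HasClassNumber (QuadOrder a b) (N / 2 + 1) := by
  refine areAllIdealClasses_and_hasClassNumber_of_forall_le hπ hc hN fun k d hkd => ?_
  obtain ⟨hd, hsub⟩ := (isOverorder_sub_iff hc).mp hkd
  have hd2 : (π ^ k) ^ 2 ∣ d ^ 2 := pow_dvd_pow_of_dvd (h2.dvd_mul_left.mp hd) 2
  rw [dvd_sub_left hd2, ← pow_mul, pow_dvd_iff_le_addVal hπ, hN] at hsub
  rw [mul_comm]
  exact_mod_cast hsub

theorem areAllIdealClasses_and_hasClassNumber_of_odd (hπ : Irreducible π) (hc : 2 * c = a)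
    {N : ℕ} (hN : addVal R (c ^ 2 + b) = N) (hodd : Odd N) :
    AreAllIdealClasses R (fun k : Fin (N / 2 + 1) => ι (π ^ (k : ℕ))) (fun _ => θ - ι c) ∧
      HasClassNumber (QuadOrder a b) (N / 2 + 1) := by
  refine areAllIdealClasses_and_hasClassNumber_of_forall_le hπ hc hN fun k d hkd => ?_
  by_contra! hlt
  obtain ⟨n, -, rfl⟩ := exists_addVal_eq_of_lt_addVal_sub_sq hN
    (((isOverorder_pow_sub_iff hπ hc).mp hkd).2.trans_lt' (by exact_mod_cast hlt))
  exact Nat.not_odd_iff_even.mpr (even_two_mul n) hodd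

theorem areAllIdealClasses_of_even (hπ : Irreducible π) (hc : 2 * c = a) {n e m : ℕ}
    (hn : addVal R (c ^ 2 + b) = (2 * n : ℕ)) (he : addVal R 2 = e)
    (hm : IsGreatest (squareLevelSet e (c ^ 2 + b)) m) {r : R}
    (hr : ((2 * m : ℕ) : ℕ∞) + addVal R (c ^ 2 + b) ≤ addVal R (c ^ 2 + b - r ^ 2)) :
    AreAllIdealClasses R
      (Sum.elim (fun k : Fin (n + 1) => ι (π ^ (k : ℕ)))
        (fun i : Fin m => ι (π ^ (n + ((i : ℕ) + 1)))))
      (Sum.elim (fun _ => θ - ι c) (fun _ => ι r + θ - ι c)) := by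
  let k : Fin (n + 1) ⊕ Fin m → ℕ := Sum.elim (fun i => i) fun i => n + (i + 1)
  let u : Fin (n + 1) ⊕ Fin m → R := Sum.elim (fun _ => -c) fun _ => r - c
  have hk : k.Injective :=
    Fin.val_injective.sumElim (fun i j hij => Fin.ext (by lia)) fun i j => by lia
  have hu : ∀ i, IsOverorder a b (π ^ k i) (u i) := by
    rintro (i | i)
    · refine (isOverorder_pow_neg_iff hπ hc).mpr ?_
      rw [hn]
      exact_mod_cast Nat.mul_le_mul_left 2 (Nat.lt_succ_iff.mp i.2)
    · exact ((isOverorder_pow_add_sub_iff hπ hc hn he).mpr ⟨hm.1.1, hr⟩).of_dvd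
        (pow_dvd_pow π (Nat.add_le_add_left i.2 n))
  have hrange : overorderLevels π a b ⊆ Set.range k := by
    intro l hl
    have hlm := (isGreatest_overorderLevels_of_even hπ hc hn he hm).2 hl
    rcases Nat.lt_or_ge l (n + 1) with hln | hln
    · exact ⟨.inl ⟨l, hln⟩, rfl⟩
    · exact ⟨.inr ⟨l - n - 1, by lia⟩, by simp only [k, Sum.elim_inr]; lia⟩
  convert areAllIdealClasses hπ hk hu hrange using 1
  · ext (i | i) <;> rfl
  · ext (i | i) <;> simp [u]

theorem exists_isGreatest_squareLevelSet_and_hasClassNumber (hπ : Irreducible π)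
    (hc : 2 * c = a) {N e : ℕ} (hN : addVal R (c ^ 2 + b) = N) (he : addVal R 2 = e)
    (heven : Even N) :
    ∃ m : ℕ, IsGreatest (squareLevelSet e (c ^ 2 + b)) m ∧
      (∀ r : R, ((2 * m : ℕ) : ℕ∞) + addVal R (c ^ 2 + b) ≤ addVal R (c ^ 2 + b - r ^ 2) →
        AreAllIdealClasses R
          (Sum.elim (fun k : Fin (N / 2 + 1) => ι (π ^ (k : ℕ)))
            (fun i : Fin m => ι (π ^ (N / 2 + ((i : ℕ) + 1)))))
          (Sum.elim (fun _ => θ - ι c) (fun _ => ι r + θ - ι c))) ∧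
      HasClassNumber (QuadOrder a b) (N / 2 + m + 1) := by
  obtain ⟨n, rfl⟩ := even_iff_exists_two_mul.mp heven
  obtain ⟨m, hm⟩ := exists_isGreatest_squareLevelSet e (c ^ 2 + b)
  rw [Nat.mul_div_cancel_left n two_pos]
  exact ⟨m, hm, fun r hr => areAllIdealClasses_of_even hπ hc hN he hm hr,
    hasClassNumber_of_isGreatest hπ (isGreatest_overorderLevels_of_even hπ hc hN he hm)⟩

end Half

section CharTwo

theorem addVal_lt_addVal_two_of_disc_ne_zero (h2 : (2 : R) = 0) (h : a ^ 2 + 4 * b ≠ 0) :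
    addVal R a < addVal R 2 := by
  rw [h2, AddValuation.map_zero, lt_top_iff_ne_top, Ne, IsDiscreteValuationRing.addVal_eq_top_iff]
  rintro rfl
  exact h (by linear_combination 2 * b * h2)

theorem isOverorder_zero_pow_iff (hπ : Irreducible π) (h2 : (2 : R) = 0) {i : ℕ} {u : R} :
    IsOverorder 0 b (π ^ i) u ↔ ∃ s, IsSolutionAt π b i u s := by
  rw [IsOverorder, h2, zero_mul, zero_add, add_zero, and_iff_right (dvd_zero _)]
  constructor
  · rintro ⟨x, hx⟩
    exact ⟨π ^ i * x, by linear_combination -hx,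
      (pow_dvd_iff_le_addVal hπ).mp (dvd_mul_right _ x)⟩
  · rintro ⟨s, hs, hi⟩
    obtain ⟨x, rfl⟩ := (pow_dvd_iff_le_addVal hπ).mpr hi
    exact ⟨x, by linear_combination -hs⟩

theorem mem_overorderLevels_zero_iff (hπ : Irreducible π) (h2 : (2 : R) = 0) {i : ℕ} :
    i ∈ overorderLevels π 0 b ↔ ∃ u s, IsSolutionAt π b i u s :=
  exists_congr fun _ => isOverorder_zero_pow_iff hπ h2

theorem areAllIdealClasses_of_isSolutionAt [IsDomain (QuadOrder 0 b)] (hπ : Irreducible π)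
    (h2 : (2 : R) = 0) {u s : ℕ → R}
    (hus : ∀ i, (∃ u' s', IsSolutionAt π b i u' s') → IsSolutionAt π b i (u i) (s i)) :
    AreAllIdealClasses R
      (fun i : {i : ℕ // ∃ u' s', IsSolutionAt π b i u' s'} =>
        algebraMap R (QuadOrder 0 b) (s i))
      (fun i => algebraMap R (QuadOrder 0 b) (u i) + quadRoot 0 b) := by
  have hnorm (i : {i : ℕ // ∃ u' s', IsSolutionAt π b i u' s'}) :
      b - u i * (u i + 0) = s i * π ^ (i : ℕ) := by
    linear_combination -(hus i i.2).1
  refine areAllIdealClasses_of_idealEquiv (k := Subtype.val) (r := fun i => u i) hπ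
    Subtype.val_injective (fun i => (isOverorder_zero_pow_iff hπ h2).mpr ⟨s i, hus i i.2⟩)
    (fun i hi => ⟨⟨i, (mem_overorderLevels_zero_iff hπ h2).mp hi⟩, rfl⟩)
    (fun i => ⟨_, hnorm i⟩) fun i => ?_
  have hneg : -u i - 0 = u i := by linear_combination -u i * h2
  simpa only [hneg] using idealEquiv_conj (hnorm i)

end CharTwo

end Valuation

end QuadOrder

theorem theorem22 {R K : Type*} [CommRing R] [IsDomain R] [IsDiscreteValuationRing R]
    [Field K] [Algebra R K] [IsFractionRing R K]
    (π : R) (hπ : Irreducible π) (a b : R) (hf : Irreducible (quadPoly a b)) :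
    let v := IsDiscreteValuationRing.addVal R
    let ι := algebraMap R (QuadOrder a b)
    let θ := quadRoot a b
    let Sep := ((quadPoly a b).map (algebraMap R K)).Separable
    -- finiteness
    (¬ (CharP K 2 ∧ ¬ Sep) → Finite (IdealClasses (QuadOrder a b))) ∧
    -- `2` is a unit; here `c = a / 2`
    (IsUnit (2 : R) → ∃ c : R, 2 * c = a ∧ ∃ N : ℕ, v (c ^ 2 + b) = N ∧
      AreAllIdealClasses R (fun k : Fin (N / 2 + 1) => ι (π ^ (k : ℕ))) (fun _ => θ - ι c) ∧
      HasClassNumber (QuadOrder a b) (N / 2 + 1)) ∧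
    -- `0 < v(2) = e < ∞`
    (∀ e : ℕ, 0 < e → v 2 = e →
      (v a < e → ∃ m : ℕ, IsGreatest (levelSet a b) m ∧
        (∀ r : R, ((2 * m : ℕ) : ℕ∞) ≤ v (b - r * (r + a)) →
          AreAllIdealClasses R (fun k : Fin (m + 1) => ι (π ^ (k : ℕ))) (fun _ => ι r + θ)) ∧
        HasClassNumber (QuadOrder a b) (m + 1)) ∧
      (e ≤ v a → ∃ c : R, 2 * c = a ∧ ∃ Δ : R, Δ = c ^ 2 + b ∧ (θ - ι c) ^ 2 = ι Δ ∧
        ∃ N : ℕ, v Δ = N ∧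
        (Odd N →
          AreAllIdealClasses R (fun k : Fin (N / 2 + 1) => ι (π ^ (k : ℕ)))
            (fun _ => θ - ι c) ∧
          HasClassNumber (QuadOrder a b) (N / 2 + 1)) ∧
        (Even N → ∃ m : ℕ, IsGreatest (squareLevelSet e Δ) m ∧
          (∀ r : R, ((2 * m : ℕ) : ℕ∞) + v Δ ≤ v (Δ - r ^ 2) →
            AreAllIdealClasses R
              (Sum.elim (fun k : Fin (N / 2 + 1) => ι (π ^ (k : ℕ)))
                (fun i : Fin m => ι (π ^ (N / 2 + ((i : ℕ) + 1)))))
              (Sum.elim (fun _ => θ - ι c) (fun _ => ι r + θ - ι c))) ∧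
          HasClassNumber (QuadOrder a b) (N / 2 + m + 1)))) ∧
    -- characteristic `2`
    ((2 : R) = 0 →
      (Sep → ∃ m : ℕ, IsGreatest (levelSet a b) m ∧
        (∀ r : R, ((2 * m : ℕ) : ℕ∞) ≤ v (b - r * (r + a)) →
          AreAllIdealClasses R (fun k : Fin (m + 1) => ι (π ^ (k : ℕ))) (fun _ => ι r + θ)) ∧
        HasClassNumber (QuadOrder a b) (m + 1)) ∧
      (¬ Sep → a = 0 ∧ ι b = θ ^ 2 ∧
        (∀ u s : ℕ → R,
          (∀ i, (∃ u' s', IsSolutionAt π b i u' s') → IsSolutionAt π b i (u i) (s i)) →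
          AreAllIdealClasses R
            (fun i : {i : ℕ // ∃ u' s', IsSolutionAt π b i u' s'} => ι (s i))
            (fun i => ι (u i) + θ)) ∧
        (Infinite (IdealClasses (QuadOrder a b)) ↔ ∀ i, ∃ u s, IsSolutionAt π b i u s))) := by
  have := QuadOrder.isDomain hf
  have hsep : _ ↔ a ^ 2 + 4 * b ≠ 0 := separable_map_quadPoly_iff (K := K)
  have hdisc := QuadOrder.two_eq_zero_and_eq_zero_of_disc_eq_zero (a := a) (b := b)
  refine ⟨fun h => ?_, fun h2 => ?_, fun e _ he2 => ⟨fun hae => ?_, fun hea => ?_⟩,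
    fun h2 => ⟨fun h => ?_, fun h => ?_⟩⟩
  · refine QuadOrder.finite_idealClasses hπ fun h0 => h ⟨?_, fun h' => hsep.mp h' h0⟩
    exact CharTwo.of_one_ne_zero_of_two_eq_zero one_ne_zero
      (by rw [← map_ofNat (algebraMap R K) 2, (hdisc h0).1, map_zero])
  · obtain ⟨c, rfl⟩ := h2.dvd (a := a)
    obtain ⟨N, hN⟩ := exists_addVal_eq (QuadOrder.sq_add_ne_zero (b := b) (c := c) rfl)
    exact ⟨c, rfl, N, hN,
      QuadOrder.areAllIdealClasses_and_hasClassNumber_of_isUnit_two hπ h2 rfl hN⟩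
  · exact QuadOrder.exists_isGreatest_levelSet_and_hasClassNumber hπ (he2 ▸ hae)
  · obtain ⟨c, rfl⟩ := IsDiscreteValuationRing.addVal_le_iff_dvd.mp (he2.trans_le hea)
    obtain ⟨N, hN⟩ := exists_addVal_eq (QuadOrder.sq_add_ne_zero (b := b) (c := c) rfl)
    exact ⟨c, rfl, _, rfl, QuadOrder.quadRoot_sub_sq rfl, N, hN,
      QuadOrder.areAllIdealClasses_and_hasClassNumber_of_odd hπ rfl hN,
      QuadOrder.exists_isGreatest_squareLevelSet_and_hasClassNumber hπ rfl hN he2⟩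
  · exact QuadOrder.exists_isGreatest_levelSet_and_hasClassNumber hπ
      (QuadOrder.addVal_lt_addVal_two_of_disc_ne_zero h2 (hsep.mp h))
  · obtain ⟨-, rfl⟩ := hdisc (not_not.mp (hsep.not.mp h))
    exact ⟨rfl, by simp [QuadOrder.quadRoot_sq],
      fun u s => QuadOrder.areAllIdealClasses_of_isSolutionAt hπ h2,
      by simp only [QuadOrder.infinite_idealClasses_iff hπ,
        QuadOrder.mem_overorderLevels_zero_iff hπ h2]⟩
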